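/- Fix a finite alphabet $\Sigma$. Let $G$ be a context-free grammar over $\Sigma$ in Chomsky normal form (every rule is $v\to zu$ with nonterminals $z,u$, or $v\to a$ with a letter $a$, or $s\to\epsilon$ for the start symbol $s$), with $T$ nonterminals, and let $\mathcal A$ be a safety NFA over $\Sigma$ (every state is accepting) with state set $Q$, $|Q|=n$. For words let $ed(w_1,w_2)$ be the least number of single letter insertions, deletions and substitutions that transform $w_1$ into $w_2$, and for languages let $ed(L_1,L_2)=\sup_{w_1\in L_1}\inf_{w_2\in L_2}ed(w_1,w_2)\in\mathbb N\cup\{\infty\}$. A compact $G$-decomposition of $w\in L(G)$ is a factorization $w=s_1u_1s_2u_2\cdots s_ku_ks_{k+1}$ such that $w(\ell):=s_1u_1^\ell s_2u_2^\ell\cdots s_ku_k^\ell s_{k+1}\in L(G)$ for every $\ell\ge 0$, $|w(0)|=\sum_{i=1}^{k+1}|s_i|\le 2^T$, and $k\le 2^{T+1}-2$. For a word $u$ and $X\subseteq Q$ let $R(u,X)$ be the set of states that can be reached, upon reading some word $ux$ with $x\in\Sigma^*$ arbitrary, from some state in $X$. Consider the following conditions: (i) $ed(L(G),L(\mathcal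 A))=\infty$; (ii) $ed(L(G),L(\mathcal A))>(2^{T+1}-2)\,n+2^T$; (iii) there is a word $w\in L(G)$ with a compact $G$-decomposition $w=s_1u_1\cdots s_ku_ks_{k+1}$ such that $R(u_k,R(u_{k-1},\ldots R(u_1,Q)\ldots))=\emptyset$. Then (i) and (ii) are equivalent, and (iii) implies them. If moreover every state of $\mathcal A$ is reachable from an initial state, then (i), (ii) and (iii) are equivalent. -/

import Mathlib

namespace FED

universe u v

/-- `SingleEdit v w`: the word `w` arises from `v` by one insertion, deletion or substitution of a
letter. -/
inductive SingleEdit {α : Type u} : List α → List α → Prop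
  | insert (x y : List α) (a : α) : SingleEdit (x ++ y) (x ++ a :: y)
  | delete (x y : List α) (a : α) : SingleEdit (x ++ a :: y) (x ++ y)
  | substitute (x y : List α) (a b : α) : SingleEdit (x ++ a :: y) (x ++ b :: y)

/-- `EditsIn m v w`: the word `v` can be transformed into `w` by exactly `m` single letter
operations. -/
inductive EditsIn {α : Type u} : ℕ → List α → List α → Prop
  | refl (w : List α) : EditsIn 0 w w
  | tail {m : ℕ} {v w z : List α} : EditsIn m v w → SingleEdit w z → EditsIn (m + 1) v z

/-- The edit distance between two words: the minimal number of single letter operations that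
transform `v` into `w`. -/
noncomputable def editDist {α : Type u} (v w : List α) : ℕ∞ :=
  ⨅ (m : ℕ) (_ : EditsIn m v w), (m : ℕ∞)

/-- The edit distance from a language to a language: `sup_{v ∈ L₁} inf_{w ∈ L₂} ed(v, w)`. -/
noncomputable def langEditDist {α : Type u} (L₁ L₂ : Language α) : ℕ∞ :=
  ⨆ v ∈ L₁, ⨅ w ∈ L₂, editDist v w

/-- Chomsky normal form: every rule is `v → z u`, or `v → a` with a letter `a`, or
`start → ε`. -/
def IsChomskyNormalForm {α : Type u} (G : ContextFreeGrammar α) : Prop :=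
  ∀ r ∈ G.rules,
    (∃ z y : G.NT, r.output = [Symbol.nonterminal z, Symbol.nonterminal y]) ∨
    (∃ a : α, r.output = [Symbol.terminal a]) ∨
    (r.input = G.initial ∧ r.output = [])

/-- An automaton is safety if every state is accepting. -/
def IsSafety {α : Type u} {σ : Type v} (A : NFA α σ) : Prop :=
  A.accept = Set.univ

/-- Every state can be reached from an initial state. -/
def AllReachable {α : Type u} {σ : Type v} (A : NFA α σ) : Prop :=
  ∀ q : σ, ∃ x : List α, q ∈ A.evalFrom A.start x

/-- `reach A w X` is `R(w, X)`: the states reachable, upon reading any word `x`, from the states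
reachable upon reading `w` from some state of `X`. -/
def reach {α : Type u} {σ : Type v} (A : NFA α σ) (w : List α) (X : Set σ) : Set σ :=
  ⋃ q ∈ X, {p | ∃ x : List α, p ∈ A.evalFrom (A.evalFrom {q} w) x}

/-- The words `s₁, u₁, …, s_k, u_k, s_{k+1}`; `pairs` lists the pairs `(s_i, u_i)` for
`i = 1, …, k`, and `last` is `s_{k+1}`. -/
structure Decomposition (α : Type u) where
  /-- the pairs `(s_i, u_i)` -/
  pairs : List (List α × List α)
  /-- the word `s_{k+1}` -/
  last : List α

/-- The word `s₁ u₁^ℓ s₂ u₂^ℓ ⋯ s_k u_k^ℓ s_{k+1}`. -/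
def Decomposition.pump {α : Type u} (d : Decomposition α) (l : ℕ) : List α :=
  d.pairs.flatMap (fun p => p.1 ++ (List.replicate l p.2).flatten) ++ d.last

/-- `d` is a compact `G`-decomposition of `w`. -/
structure IsCompactDecomposition {α : Type u} (G : ContextFreeGrammar α) [Fintype G.NT]
    (w : List α) (d : Decomposition α) : Prop where
  eq_word : w = d.pairs.flatMap (fun p => p.1 ++ p.2) ++ d.last
  pump_mem : ∀ l : ℕ, d.pump l ∈ G.language
  length_le : (d.pump 0).length ≤ 2 ^ Fintype.card G.NT
  card_le : d.pairs.length ≤ 2 ^ (Fintype.card G.NT + 1) - 2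

/-- `R(u_k, R(u_{k-1}, … R(u_1, Q) … ))`, where `Q` is the set of all states. -/
def Decomposition.nestedReach {α : Type u} {σ : Type v} (A : NFA α σ) (d : Decomposition α) :
    Set σ :=
  d.pairs.foldl (fun X p => reach A p.2 X) Set.univ

/-- Some word of `L(G)` has a compact `G`-decomposition with empty nested reachability set. -/
def HasEmptyNestedReach {α : Type u} {σ : Type v} (G : ContextFreeGrammar α) [Fintype G.NT]
    (A : NFA α σ) : Prop :=
  ∃ w ∈ G.language, ∃ d : Decomposition α,
    IsCompactDecomposition G w d ∧ d.nestedReach A = ∅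

end FED

/-! Everything rests on one dichotomy for decompositions `s₁u₁⋯s_ku_ks_{k+1}` and a forward-closed
set `X` containing the initial states. If the distance is finite, pump with an `ℓ` exceeding it.
Fewer than `ℓ` edits spare a copy of `u_i` in each block `u_i^ℓ`, so a run on the edited word reads
`u₁, …, u_k` in order and the nested set started from `X` is nonempty
(`foldl_reach_nonempty_of_editsIn`). Conversely, if the nested set started from the reachable states
is nonempty, keep every `u_i`, replace each `s_i` with `i ≤ k` by a connecting word of at most `n`
letters and delete `s_{k+1}`. This costs at most `kn + ∑|s_i|` (`exists_editsIn_accepts`), which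
compactness bounds by the constant in (ii). Every word of `L(G)` has a compact decomposition
(`TreeIn.exists_decomposition`). Taking `X` to be the reachable states gives (i) ⇔ (ii), and taking
all states gives (iii) ⇒ (i). The two choices agree when all states are reachable. -/

namespace FED

/-! ### Edit sequences and concatenation -/

section Edits

variable {α : Type*}

lemma SingleEdit.append_left {v w : List α} (h : SingleEdit v w) (z : List α) :
    SingleEdit (z ++ v) (z ++ w) := by
  cases h with
  | insert x y a => simpa using SingleEdit.insert (z ++ x) y a
  | delete x y a => simpa using SingleEdit.delete (z ++ x) y a
  | substitute x y a b => simpa using SingleEdit.substitute (z ++ x) y a b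

lemma SingleEdit.append_right {v w : List α} (h : SingleEdit v w) (z : List α) :
    SingleEdit (v ++ z) (w ++ z) := by
  cases h with
  | insert x y a => simpa using SingleEdit.insert x (y ++ z) a
  | delete x y a => simpa using SingleEdit.delete x (y ++ z) a
  | substitute x y a b => simpa using SingleEdit.substitute x (y ++ z) a b

lemma SingleEdit.of_append {a b c : List α} (h : SingleEdit (a ++ b) c) :
    (∃ a', SingleEdit a a' ∧ c = a' ++ b) ∨ ∃ b', SingleEdit b b' ∧ c = a ++ b' := by
  generalize hv : a ++ b = v at h
  cases h with
  | insert x y l =>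
    rcases List.append_eq_append_iff.1 hv with ⟨t, rfl, rfl⟩ | ⟨t, rfl, rfl⟩
    · exact .inr ⟨_, .insert t y l, by simp⟩
    · exact .inl ⟨_, .insert x t l, by simp⟩
  | delete x y l =>
    rcases List.append_eq_append_iff.1 hv with ⟨t, rfl, rfl⟩ | ⟨t, rfl, ht⟩
    · exact .inr ⟨_, .delete t y l, by simp⟩
    -- If `t` is empty, the edited letter is the first letter of `b`, so the edit belongs to the
    -- right factor.
    · cases t with
      | nil =>
        obtain rfl : l :: y = b := by simpa using ht
        exact .inr ⟨_, .delete [] y l, by simp⟩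
      | cons e t =>
        obtain ⟨rfl, rfl⟩ : l = e ∧ y = t ++ b := by simpa using ht
        exact .inl ⟨_, .delete x t l, by simp⟩
  | substitute x y l l' =>
    rcases List.append_eq_append_iff.1 hv with ⟨t, rfl, rfl⟩ | ⟨t, rfl, ht⟩
    · exact .inr ⟨_, .substitute t y l l', by simp⟩
    · cases t with
      | nil =>
        obtain rfl : l :: y = b := by simpa using ht
        exact .inr ⟨_, .substitute [] y l l', by simp⟩
      | cons e t =>
        obtain ⟨rfl, rfl⟩ : l = e ∧ y = t ++ b := by simpa using ht
        exact .inl ⟨_, .substitute x t l l', by simp⟩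

lemma EditsIn.append_left {m : ℕ} {v w : List α} (h : EditsIn m v w) (z : List α) :
    EditsIn m (z ++ v) (z ++ w) := by
  induction h with
  | refl w => exact .refl _
  | tail _ hs ih => exact ih.tail (hs.append_left z)

lemma EditsIn.append_right {m : ℕ} {v w : List α} (h : EditsIn m v w) (z : List α) :
    EditsIn m (v ++ z) (w ++ z) := by
  induction h with
  | refl w => exact .refl _
  | tail _ hs ih => exact ih.tail (hs.append_right z)

lemma EditsIn.trans {m k : ℕ} {v w z : List α} (h : EditsIn m v w) (h' : EditsIn k w z) :
    EditsIn (m + k) v z := by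
  induction h' with
  | refl w => exact h
  | tail _ hs ih => exact (ih h).tail hs

lemma EditsIn.append {m k : ℕ} {v v' w w' : List α} (h : EditsIn m v v') (h' : EditsIn k w w') :
    EditsIn (m + k) (v ++ w) (v' ++ w') :=
  (h.append_right w).trans (h'.append_left v')

lemma editsIn_nil_right (w : List α) : EditsIn w.length w [] := by
  induction w with
  | nil => exact .refl _
  | cons a w ih =>
    have h : EditsIn 1 [a] [] := (EditsIn.refl _).tail (.delete [] [] a)
    simpa [add_comm] using h.append ih

lemma editsIn_nil_left (w : List α) : EditsIn w.length [] w := by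
  induction w with
  | nil => exact .refl _
  | cons a w ih =>
    have h : EditsIn 1 [] [a] := (EditsIn.refl _).tail (.insert [] [] a)
    simpa [add_comm] using h.append ih

lemma EditsIn.eq_of_zero {v w : List α} (h : EditsIn 0 v w) : v = w := by
  cases h; rfl

/-- Each edit acts inside one of the two factors, so the cut point can be carried along and the
edits counted separately on each side. -/
lemma EditsIn.exists_of_append {m : ℕ} {a b c : List α} (h : EditsIn m (a ++ b) c) :
    ∃ a' b' i j, c = a' ++ b' ∧ EditsIn i a a' ∧ EditsIn j b b' ∧ i + j = m := by
  generalize hv : a ++ b = v at h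
  induction h with
  | refl w => exact ⟨a, b, 0, 0, hv.symm, .refl _, .refl _, rfl⟩
  | tail _ hs ih =>
    obtain ⟨a', b', i, j, rfl, ha, hb, hij⟩ := ih hv
    rcases hs.of_append with ⟨a'', ha', rfl⟩ | ⟨b'', hb', rfl⟩
    · exact ⟨a'', b', i + 1, j, rfl, ha.tail ha', hb, by omega⟩
    · exact ⟨a', b'', i, j + 1, rfl, ha, hb.tail hb', by omega⟩

/-- Fewer than `l` edits leave one of `l` consecutive copies of a word untouched. -/
lemma EditsIn.exists_infix_of_replicate {l m : ℕ} {u w : List α} (hm : m < l)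
    (h : EditsIn m (List.replicate l u).flatten w) : ∃ x y, w = x ++ u ++ y := by
  induction l generalizing m w with
  | zero => omega
  | succ l ih =>
    rw [List.replicate_succ, List.flatten_cons] at h
    obtain ⟨a, b, i, j, rfl, ha, hb, hij⟩ := h.exists_of_append
    cases i with
    | zero => exact ⟨[], b, by simp [ha.eq_of_zero]⟩
    | succ i =>
      obtain ⟨x, y, rfl⟩ := ih (by omega) hb
      exact ⟨a ++ x, y, by simp⟩

lemma editDist_le_of_editsIn {m : ℕ} {v w : List α} (h : EditsIn m v w) :
    editDist v w ≤ m :=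
  iInf₂_le m h

lemma exists_editsIn_of_editDist_lt {m : ℕ} {v w : List α} (h : editDist v w < m) :
    ∃ k < m, EditsIn k v w := by
  obtain ⟨k, hk⟩ := iInf_lt_iff.1 h
  obtain ⟨hk, hlt⟩ := iInf_lt_iff.1 hk
  exact ⟨k, by exact_mod_cast hlt, hk⟩

lemma exists_bound_of_langEditDist_ne_top {L₁ L₂ : Language α} (h : langEditDist L₁ L₂ ≠ ⊤) :
    ∃ l : ℕ, ∀ v ∈ L₁, ∃ w ∈ L₂, ∃ m < l, EditsIn m v w := by
  obtain ⟨N, hN⟩ := ENat.ne_top_iff_exists.1 h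
  refine ⟨N + 1, fun v hv => ?_⟩
  have h1 : (⨅ w ∈ L₂, editDist v w) < ((N + 1 : ℕ) : ℕ∞) := by
    refine (le_iSup₂ (f := fun v (_ : v ∈ L₁) => ⨅ w ∈ L₂, editDist v w) v hv).trans_lt ?_
    change langEditDist L₁ L₂ < _
    rw [← hN]
    exact_mod_cast Nat.lt_succ_self N
  obtain ⟨w, hw⟩ := iInf_lt_iff.1 h1
  obtain ⟨hw, hlt⟩ := iInf_lt_iff.1 hw
  exact ⟨w, hw, exists_editsIn_of_editDist_lt hlt⟩

lemma langEditDist_le_of_forall {L₁ L₂ : Language α} {N : ℕ}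
    (h : ∀ v ∈ L₁, ∃ w ∈ L₂, ∃ m ≤ N, EditsIn m v w) : langEditDist L₁ L₂ ≤ N := by
  refine iSup₂_le fun v hv => ?_
  obtain ⟨w, hw, m, hm, he⟩ := h v hv
  exact (iInf₂_le w hw).trans ((editDist_le_of_editsIn he).trans (by exact_mod_cast hm))

end Edits

/-! ### Runs and nested reachability -/

section Automata

variable {α σ : Type*}

lemma mem_evalFrom_append_iff (A : NFA α σ) {S : Set σ} {x y : List α} {p : σ} :
    p ∈ A.evalFrom S (x ++ y) ↔ ∃ r ∈ A.evalFrom S x, p ∈ A.evalFrom {r} y := by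
  rw [NFA.evalFrom_append, NFA.mem_evalFrom_iff_exists]

lemma mem_reach_iff (A : NFA α σ) {u : List α} {X : Set σ} {p : σ} :
    p ∈ reach A u X ↔ ∃ q ∈ X, ∃ r ∈ A.evalFrom {q} u, ∃ x, p ∈ A.evalFrom {r} x := by
  simp only [reach, Set.mem_iUnion, Set.mem_ofPred_eq, exists_prop]
  constructor
  · rintro ⟨q, hq, x, hx⟩
    obtain ⟨r, hr, hp⟩ := NFA.mem_evalFrom_iff_exists.1 hx
    exact ⟨q, hq, r, hr, x, hp⟩
  · rintro ⟨q, hq, r, hr, x, hp⟩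
    exact ⟨q, hq, x, NFA.mem_evalFrom_iff_exists.2 ⟨r, hr, hp⟩⟩

/-- A state that can be reached at all can be reached by a word no longer than the number of
states. -/
lemma exists_short_word [Fintype σ] (A : NFA α σ) {S : Set σ} {p : σ} {x : List α}
    (h : p ∈ A.evalFrom S x) : ∃ y : List α, y.length ≤ Fintype.card σ ∧ p ∈ A.evalFrom S y := by
  induction hn : x.length using Nat.strong_induction_on generalizing x with
  | _ n ih =>
    by_cases hx : x.length ≤ Fintype.card σ
    · exact ⟨x, hx, h⟩
    have hsplit : ∀ i : Fin (x.length + 1),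
        ∃ r, r ∈ A.evalFrom S (x.take i) ∧ p ∈ A.evalFrom {r} (x.drop i) := by
      intro i
      rw [← List.take_append_drop i x] at h
      exact (mem_evalFrom_append_iff A).1 h
    choose f hf using hsplit
    -- Pigeonhole on the `|x| + 1` cut points. The states `f i` need not lie on one run: removing
    -- the letters between two cuts only uses that `f i` is reached by the prefix and leads to `p`
    -- by the suffix.
    obtain ⟨i, j, hij, hfij⟩ := Fintype.exists_ne_map_eq_of_card_lt f (by simp; omega)
    wlog hlt : i < j generalizing i j
    · exact this j i hij.symm hfij.symm (lt_of_le_of_ne (not_lt.1 hlt) hij.symm)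
    have hlt' : (i : ℕ) < j := hlt
    refine ih _ ?_ (x := x.take i ++ x.drop j)
      ((mem_evalFrom_append_iff A).2 ⟨f i, (hf i).1, hfij ▸ (hf j).2⟩) rfl
    have := j.2
    simp only [List.length_append, List.length_take, List.length_drop]
    omega

/-- `X` contains every state that can be reached from it. -/
def IsForwardClosed (A : NFA α σ) (X : Set σ) : Prop :=
  ∀ q ∈ X, ∀ x, A.evalFrom {q} x ⊆ X

lemma isForwardClosed_reach (A : NFA α σ) (u : List α) (X : Set σ) :
    IsForwardClosed A (reach A u X) := by
  intro p hp y p' hp'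
  obtain ⟨q, hq, r, hr, x, hx⟩ := (mem_reach_iff A).1 hp
  exact (mem_reach_iff A).2 ⟨q, hq, r, hr, x ++ y, (mem_evalFrom_append_iff A).2 ⟨p, hx, hp'⟩⟩

/-- A run on the edited word meets an intact copy of each `u_i`. Forward closure of `X` absorbs
whatever is read before that copy, and `reach` absorbs what follows it. -/
lemma foldl_reach_nonempty_of_editsIn (A : NFA α σ) {l : ℕ} {last : List α}
    (ps : List (List α × List α)) {m : ℕ} (hm : m < l) {w : List α} {X : Set σ}
    (hX : IsForwardClosed A X) {q : σ} (hq : q ∈ X)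
    (he : EditsIn m (ps.flatMap (fun p => p.1 ++ (List.replicate l p.2).flatten) ++ last) w)
    (hw : (A.evalFrom {q} w).Nonempty) :
    (ps.foldl (fun X p => reach A p.2 X) X).Nonempty := by
  induction ps generalizing m w X q with
  | nil => exact ⟨q, hq⟩
  | cons p ps ih =>
    rw [List.flatMap_cons, List.append_assoc, List.append_assoc] at he
    obtain ⟨s', w', i, j, rfl, -, he', hij⟩ := he.exists_of_append
    obtain ⟨u', w'', i', j', rfl, hu, hrest, hij'⟩ := he'.exists_of_append
    obtain ⟨x, y, rfl⟩ := hu.exists_infix_of_replicate (by omega)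
    obtain ⟨t, ht⟩ := hw
    obtain ⟨q₁, hq₁, ht⟩ := (mem_evalFrom_append_iff A).1 ht
    obtain ⟨q₂, hq₂, ht⟩ := (mem_evalFrom_append_iff A).1 ht
    obtain ⟨q₃, hq₃, hq₂⟩ := (mem_evalFrom_append_iff A).1 hq₂
    obtain ⟨q₄, hq₄, hq₃⟩ := (mem_evalFrom_append_iff A).1 hq₃
    rw [List.foldl_cons]
    refine ih (m := j') (by omega) (isForwardClosed_reach A _ _) (q := q₂) ?_ hrest ⟨t, ht⟩
    exact (mem_reach_iff A).2 ⟨q₄, hX _ (hX _ hq _ hq₁) _ hq₄, q₃, hq₃, y, hq₂⟩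

/-- A state of the nested set is traced back through `u_k, …, u₁`. The gaps between these words are
bridged by short words that replace the `s_i`. -/
lemma exists_editsIn_of_foldl_reach_nonempty [Fintype σ] (A : NFA α σ)
    (ps : List (List α × List α)) {X S : Set σ} (hX : ∀ q ∈ X, ∃ x, q ∈ A.evalFrom S x)
    (h : (ps.foldl (fun X p => reach A p.2 X) X).Nonempty) :
    ∃ w, (A.evalFrom S w).Nonempty ∧
      ∃ m ≤ ps.length * Fintype.card σ + (ps.flatMap Prod.fst).length,
        EditsIn m (ps.flatMap (fun p => p.1 ++ p.2)) w := by
  induction ps generalizing X S with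
  | nil =>
    obtain ⟨q, hq⟩ := h
    obtain ⟨x, hx⟩ := hX q hq
    obtain ⟨q₀, hq₀, -⟩ := NFA.mem_evalFrom_iff_exists.1 hx
    exact ⟨[], ⟨q₀, hq₀⟩, 0, Nat.zero_le _, .refl _⟩
  | cons p ps ih =>
    obtain ⟨s, u⟩ := p
    obtain ⟨w, ⟨t, ht⟩, m, hm, he⟩ := ih (X := reach A u X) (S := A.evalFrom X u) (by
      intro q hq
      obtain ⟨q₁, hq₁, r, hr, x, hx⟩ := (mem_reach_iff A).1 hq
      exact ⟨x, NFA.mem_evalFrom_iff_exists.2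
        ⟨r, NFA.mem_evalFrom_iff_exists.2 ⟨q₁, hq₁, hr⟩, hx⟩⟩) h
    rw [← NFA.evalFrom_append] at ht
    obtain ⟨q, hq, ht⟩ := NFA.mem_evalFrom_iff_exists.1 ht
    obtain ⟨x, hx⟩ := hX q hq
    obtain ⟨y, hy, hqy⟩ := exists_short_word A hx
    -- Delete `s` and insert the bridge `y` from `S` to `q`; the factor `u` is left untouched.
    refine ⟨y ++ (u ++ w), ⟨t, (mem_evalFrom_append_iff A).2 ⟨q, hqy, ht⟩⟩,
      s.length + y.length + m, ?_, ?_⟩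
    · simp only [List.length_cons, List.flatMap_cons, List.length_append, Nat.add_mul, one_mul]
      omega
    · have h1 : EditsIn (s.length + y.length) s y := (editsIn_nil_right s).trans (editsIn_nil_left y)
      simpa using h1.append (he.append_left u)

/-- The states reachable from an initial state. -/
def reachable (A : NFA α σ) : Set σ := {q | ∃ x, q ∈ A.evalFrom A.start x}

lemma isForwardClosed_reachable (A : NFA α σ) : IsForwardClosed A (reachable A) := by
  rintro q ⟨x, hx⟩ y p hp
  exact ⟨x ++ y, (mem_evalFrom_append_iff A).2 ⟨q, hx, hp⟩⟩

lemma reachable_eq_univ {A : NFA α σ} (h : AllReachable A) : reachable A = Set.univ :=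
  Set.eq_univ_of_forall h

lemma mem_accepts_iff_nonempty {A : NFA α σ} (hA : IsSafety A) {w : List α} :
    w ∈ A.accepts ↔ (A.evalFrom A.start w).Nonempty := by
  have h : A.accept = Set.univ := hA
  rw [NFA.mem_accepts]
  simp [h, Set.Nonempty]

lemma foldl_reach_nonempty_of_langEditDist_ne_top {A : NFA α σ} {L : Language α}
    (h : langEditDist L A.accepts ≠ ⊤) {d : Decomposition α} (hd : ∀ l, d.pump l ∈ L)
    {X : Set σ} (hX : IsForwardClosed A X) (hS : A.start ⊆ X) :
    (d.pairs.foldl (fun X p => reach A p.2 X) X).Nonempty := by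
  obtain ⟨l, hl⟩ := exists_bound_of_langEditDist_ne_top h
  obtain ⟨w, hw, m, hm, he⟩ := hl _ (hd l)
  obtain ⟨p, -, hp⟩ := NFA.mem_accepts.1 hw
  obtain ⟨q, hq, hp⟩ := NFA.mem_evalFrom_iff_exists.1 hp
  exact foldl_reach_nonempty_of_editsIn A d.pairs hm hX (hS hq) he ⟨p, hp⟩

lemma exists_editsIn_accepts [Fintype σ] {A : NFA α σ} (hA : IsSafety A) (d : Decomposition α)
    (h : (d.pairs.foldl (fun X p => reach A p.2 X) (reachable A)).Nonempty) :
    ∃ w ∈ A.accepts, ∃ m ≤ d.pairs.length * Fintype.card σ + (d.pump 0).length,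
      EditsIn m (d.pairs.flatMap (fun p => p.1 ++ p.2) ++ d.last) w := by
  obtain ⟨w, hw, m, hm, he⟩ :=
    exists_editsIn_of_foldl_reach_nonempty A d.pairs (S := A.start) (fun q hq => hq) h
  refine ⟨w, (mem_accepts_iff_nonempty hA).2 hw, m + d.last.length, ?_, ?_⟩
  · have h0 : (d.pump 0).length = (d.pairs.flatMap Prod.fst).length + d.last.length := by
      simp [Decomposition.pump, List.length_flatMap]
    omega
  · simpa using he.append (editsIn_nil_right d.last)

end Automata

/-! ### Derivation trees and compact decompositions -/

section Grammars

variable {α : Type*} {G : ContextFreeGrammar α}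

/-- `TreeIn G P v w`: the nonterminal `v` has a derivation tree with yield `w` in which only
nonterminals of `P` occur. -/
inductive TreeIn (G : ContextFreeGrammar α) (P : Finset G.NT) : G.NT → List α → Prop
  | eps {v : G.NT} (hv : v ∈ P) (hr : ⟨v, []⟩ ∈ G.rules) : TreeIn G P v []
  | leaf {v : G.NT} {a : α} (hv : v ∈ P) (hr : ⟨v, [Symbol.terminal a]⟩ ∈ G.rules) :
      TreeIn G P v [a]
  | node {v z y : G.NT} {w₁ w₂ : List α} (hv : v ∈ P)
      (hr : ⟨v, [Symbol.nonterminal z, Symbol.nonterminal y]⟩ ∈ G.rules)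
      (h₁ : TreeIn G P z w₁) (h₂ : TreeIn G P y w₂) : TreeIn G P v (w₁ ++ w₂)

/-- `SubtreesIn G P v w`: the nonterminal `v` has a derivation tree with yield `w` in which only
nonterminals of `P` occur below the root. -/
inductive SubtreesIn (G : ContextFreeGrammar α) (P : Finset G.NT) : G.NT → List α → Prop
  | eps {v : G.NT} (hr : ⟨v, []⟩ ∈ G.rules) : SubtreesIn G P v []
  | leaf {v : G.NT} {a : α} (hr : ⟨v, [Symbol.terminal a]⟩ ∈ G.rules) : SubtreesIn G P v [a]
  | node {v z y : G.NT} {w₁ w₂ : List α}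
      (hr : ⟨v, [Symbol.nonterminal z, Symbol.nonterminal y]⟩ ∈ G.rules)
      (h₁ : TreeIn G P z w₁) (h₂ : TreeIn G P y w₂) : SubtreesIn G P v (w₁ ++ w₂)

lemma TreeIn.mem {P : Finset G.NT} {v : G.NT} {w : List α} (h : TreeIn G P v w) : v ∈ P := by
  cases h <;> assumption

lemma derives_of_rule {v : G.NT} {o : List (Symbol α G.NT)} (h : ⟨v, o⟩ ∈ G.rules) :
    G.Derives [Symbol.nonterminal v] o :=
  ContextFreeGrammar.Produces.single
    ⟨_, h, ContextFreeRule.Rewrites.input_output (r := ⟨v, o⟩)⟩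

lemma derives_append {a a' b b' : List (Symbol α G.NT)} (h : G.Derives a a')
    (h' : G.Derives b b') : G.Derives (a ++ b) (a' ++ b') :=
  (h.append_right b).trans (h'.append_left a')

lemma derives_of_binary_rule {v z y : G.NT} {b c : List (Symbol α G.NT)}
    (hr : ⟨v, [Symbol.nonterminal z, Symbol.nonterminal y]⟩ ∈ G.rules)
    (h₁ : G.Derives [Symbol.nonterminal z] b) (h₂ : G.Derives [Symbol.nonterminal y] c) :
    G.Derives [Symbol.nonterminal v] (b ++ c) :=
  (derives_of_rule hr).trans (derives_append h₁ h₂)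

lemma TreeIn.derives {P : Finset G.NT} {v : G.NT} {w : List α} (h : TreeIn G P v w) :
    G.Derives [Symbol.nonterminal v] (w.map Symbol.terminal) := by
  induction h with
  | eps _ hr => simpa using derives_of_rule hr
  | leaf _ hr => simpa using derives_of_rule hr
  | node _ hr _ _ ih₁ ih₂ => simpa using derives_of_binary_rule hr ih₁ ih₂

/-- A derivation tree either avoids the nonterminal `u` or has a lowest occurrence of it. -/
lemma TreeIn.erase_or_exists [DecidableEq G.NT] {P : Finset G.NT} {v : G.NT} {w : List α}
    (h : TreeIn G P v w) (u : G.NT) :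
    TreeIn G (P.erase u) v w ∨ ∃ x c y : List α, w = x ++ c ++ y ∧ SubtreesIn G (P.erase u) u c ∧
      G.Derives [Symbol.nonterminal v]
        (x.map Symbol.terminal ++ [Symbol.nonterminal u] ++ y.map Symbol.terminal) := by
  induction h with
  | @eps v hv hr =>
    by_cases huv : v = u
    · subst huv
      exact .inr ⟨[], [], [], rfl, .eps hr, .refl _⟩
    · exact .inl (.eps (Finset.mem_erase.2 ⟨huv, hv⟩) hr)
  | @leaf v a hv hr =>
    by_cases huv : v = u
    · subst huv
      exact .inr ⟨[], [a], [], rfl, .leaf hr, .refl _⟩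
    · exact .inl (.leaf (Finset.mem_erase.2 ⟨huv, hv⟩) hr)
  | @node v z y w₁ w₂ hv hr h₁ h₂ ih₁ ih₂ =>
    rcases ih₁ with ih₁ | ⟨x, c, y, rfl, hc, hd⟩
    · rcases ih₂ with ih₂ | ⟨x, c, y, rfl, hc, hd⟩
      · by_cases huv : v = u
        · subst huv
          exact .inr ⟨[], w₁ ++ w₂, [], by simp, .node hr ih₁ ih₂, .refl _⟩
        · exact .inl (.node (Finset.mem_erase.2 ⟨huv, hv⟩) hr ih₁ ih₂)
      · exact .inr ⟨w₁ ++ x, c, y, by simp, hc, by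
          simpa using derives_of_binary_rule hr h₁.derives hd⟩
    · exact .inr ⟨x, c, y ++ w₂, by simp, hc, by
        simpa using derives_of_binary_rule hr hd h₂.derives⟩

lemma derives_replicate {v : G.NT} {x y : List α}
    (h : G.Derives [Symbol.nonterminal v]
      (x.map Symbol.terminal ++ [Symbol.nonterminal v] ++ y.map Symbol.terminal)) (l : ℕ) :
    G.Derives [Symbol.nonterminal v]
      ((List.replicate l x).flatten.map Symbol.terminal ++ [Symbol.nonterminal v] ++
        (List.replicate l y).flatten.map Symbol.terminal) := by
  induction l with
  | zero => simpa using ContextFreeGrammar.Derives.refl _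
  | succ l ih =>
    have h1 := ih.trans ((h.append_left _).append_right _)
    rw [List.replicate_succ' (a := x), List.replicate_succ (a := y)]
    simpa using h1

/-- Induction on the number of allowed nonterminals. At a lowest occurrence of the root label `v`,
the context `v ⇒* x v y` can be pumped and both subtrees avoid `v`. So the number of pumped words
obeys `k(n+1) ≤ 2k(n) + 2`, while the total length of the `s_i` at most doubles. -/
lemma TreeIn.exists_decomposition [DecidableEq G.NT] {P : Finset G.NT} {v : G.NT} {w : List α}
    (h : TreeIn G P v w) :
    ∃ ps : List (List α × List α), w = ps.flatMap (fun p => p.1 ++ p.2) ∧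
      (∀ l : ℕ, G.Derives [Symbol.nonterminal v]
        ((ps.flatMap (fun p => p.1 ++ (List.replicate l p.2).flatten)).map Symbol.terminal)) ∧
      (ps.flatMap Prod.fst).length ≤ 2 ^ P.card ∧ ps.length + 2 ≤ 2 ^ (P.card + 1) := by
  induction hn : P.card generalizing P v w with
  | zero =>
    rw [Finset.card_eq_zero] at hn
    subst hn
    exact absurd h.mem (Finset.notMem_empty v)
  | succ n ih =>
    have hcard : (P.erase v).card = n := by rw [Finset.card_erase_of_mem h.mem, hn]; rfl
    have hpow : 1 ≤ 2 ^ n := Nat.one_le_two_pow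
    rcases h.erase_or_exists v with h' | ⟨x, c, y, rfl, hc, hd⟩
    · exact absurd h'.mem (Finset.notMem_erase v P)
    have hpump := derives_replicate hd
    cases hc with
    | eps hr =>
      -- The words `x` and `y` may be empty; the decomposition does not require nonempty pumped
      -- words.
      refine ⟨[([], x), ([], y)], by simp, fun l => ?_, by simp, by simp [pow_succ]; omega⟩
      simpa using (hpump l).trans (((derives_of_rule hr).append_left _).append_right _)
    | @leaf a hr =>
      refine ⟨[([], x), ([a], y)], by simp, fun l => ?_, by simp; omega, by simp [pow_succ]; omega⟩
      simpa using (hpump l).trans (((derives_of_rule hr).append_left _).append_right _)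
    | node hr h₁ h₂ =>
      obtain ⟨ps, rfl, hps, hl₁, hc₁⟩ := ih h₁ hcard
      obtain ⟨qs, rfl, hqs, hl₂, hc₂⟩ := ih h₂ hcard
      refine ⟨([], x) :: (ps ++ qs ++ [([], y)]), by simp, fun l => ?_, ?_, ?_⟩
      · simpa using (hpump l).trans
          (((derives_of_binary_rule hr (hps l) (hqs l)).append_left _).append_right _)
      · simp only [List.flatMap_cons, List.flatMap_append, List.flatMap_nil, List.length_append,
          List.length_nil, pow_succ]
        omega
      · simp only [List.length_cons, List.length_append, List.length_nil, pow_succ] at hc₁ hc₂ ⊢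
        omega

/-- `Yields G P u w`: the word `w` arises from the sentential form `u` by replacing every
nonterminal by the yield of a derivation tree. -/
inductive Yields (G : ContextFreeGrammar α) (P : Finset G.NT) :
    List (Symbol α G.NT) → List α → Prop
  | nil : Yields G P [] []
  | terminal {u : List (Symbol α G.NT)} {w : List α} (a : α) (h : Yields G P u w) :
      Yields G P (Symbol.terminal a :: u) (a :: w)
  | nonterminal {u : List (Symbol α G.NT)} {v : G.NT} {w₁ w₂ : List α} (h₁ : TreeIn G P v w₁)
      (h₂ : Yields G P u w₂) : Yields G P (Symbol.nonterminal v :: u) (w₁ ++ w₂)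

lemma yields_map_terminal (P : Finset G.NT) (w : List α) :
    Yields G P (w.map Symbol.terminal) w := by
  induction w with
  | nil => exact .nil
  | cons a w ih => exact .terminal a ih

lemma Yields.append {P : Finset G.NT} {u u' : List (Symbol α G.NT)} {w w' : List α}
    (h : Yields G P u w) (h' : Yields G P u' w') : Yields G P (u ++ u') (w ++ w') := by
  induction h with
  | nil => exact h'
  | terminal a _ ih => exact .terminal a ih
  | nonterminal h₁ _ ih => simpa using Yields.nonterminal h₁ ih

lemma Yields.exists_of_append {P : Finset G.NT} {u u' : List (Symbol α G.NT)} {w : List α}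
    (h : Yields G P (u ++ u') w) : ∃ w₁ w₂, w = w₁ ++ w₂ ∧ Yields G P u w₁ ∧ Yields G P u' w₂ := by
  induction u generalizing w with
  | nil => exact ⟨[], w, rfl, .nil, h⟩
  | cons s u ih =>
    cases h with
    | terminal a h =>
      obtain ⟨w₁, w₂, rfl, h₁, h₂⟩ := ih h
      exact ⟨a :: w₁, w₂, rfl, .terminal a h₁, h₂⟩
    | @nonterminal _ v x _ ht h =>
      obtain ⟨w₁, w₂, rfl, h₁, h₂⟩ := ih h
      exact ⟨x ++ w₁, w₂, by simp, .nonterminal ht h₁, h₂⟩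

lemma Yields.treeIn_of_rule (hG : IsChomskyNormalForm G) {P : Finset G.NT} (hP : ∀ v, v ∈ P)
    {r : ContextFreeRule α G.NT} (hr : r ∈ G.rules) {w : List α} (h : Yields G P r.output w) :
    TreeIn G P r.input w := by
  obtain ⟨v, o⟩ := r
  rcases hG _ hr with ⟨z, y, ho⟩ | ⟨a, ho⟩ | ⟨-, ho⟩ <;>
    obtain rfl : o = _ := ho
  · cases h with
    | nonterminal h₁ h =>
      cases h with
      | nonterminal h₂ h =>
        cases h
        simpa using TreeIn.node (hP v) hr h₁ h₂
  · cases h with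
    | terminal _ h =>
      cases h
      exact .leaf (hP v) hr
  · cases h
    exact .eps (hP v) hr

/-- Read the derivation backwards: undoing a rule joins the trees below its output into one tree
rooted at its input. -/
lemma yields_of_derives (hG : IsChomskyNormalForm G) {P : Finset G.NT} (hP : ∀ v, v ∈ P)
    {u : List (Symbol α G.NT)} {w : List α} (h : G.Derives u (w.map Symbol.terminal)) :
    Yields G P u w := by
  induction h using Relation.ReflTransGen.head_induction_on with
  | refl => exact yields_map_terminal P w
  | head hp _ ih =>
    obtain ⟨r, hr, hrw⟩ := hp
    obtain ⟨p, q, rfl, rfl⟩ := hrw.exists_parts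
    obtain ⟨w', w₃, rfl, h', h₃⟩ := ih.exists_of_append
    obtain ⟨w₁, w₂, rfl, h₁, h₂⟩ := h'.exists_of_append
    have h₂ : Yields G P [Symbol.nonterminal r.input] w₂ := by
      simpa using Yields.nonterminal (h₂.treeIn_of_rule hG hP hr) .nil
    exact (h₁.append h₂).append h₃

lemma exists_isCompactDecomposition [Fintype G.NT] (hG : IsChomskyNormalForm G) {w : List α}
    (hw : w ∈ G.language) : ∃ d, IsCompactDecomposition G w d := by
  classical
  have ht : TreeIn G Finset.univ G.initial w := by
    have h := yields_of_derives hG (P := Finset.univ) Finset.mem_univ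
      ((G.mem_language_iff w).1 hw)
    cases h with
    | nonterminal h₁ h =>
      cases h
      simpa using h₁
  obtain ⟨ps, hw, hpump, hlen, hcard⟩ := ht.exists_decomposition
  -- The list ends with a pumped word, so `s_{k+1}` is empty.
  refine ⟨⟨ps, []⟩, by simpa using hw, fun l => ?_, ?_, ?_⟩
  · rw [ContextFreeGrammar.mem_language_iff]
    simpa [Decomposition.pump] using hpump l
  · simpa [Decomposition.pump, List.length_flatMap] using hlen
  · rw [Finset.card_univ] at hcard
    change ps.length ≤ _
    omega

end Grammars

/-! ### Comparing the three conditions -/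

section Comparison

variable {α σ : Type*} {G : ContextFreeGrammar α} [Fintype G.NT] {A : NFA α σ}

lemma HasEmptyNestedReach.langEditDist_eq_top (h : HasEmptyNestedReach G A) :
    langEditDist G.language A.accepts = ⊤ := by
  obtain ⟨w, -, d, hd, he⟩ := h
  by_contra hne
  exact (foldl_reach_nonempty_of_langEditDist_ne_top hne hd.pump_mem (X := Set.univ)
    (fun _ _ _ => Set.subset_univ _) (Set.subset_univ _)).ne_empty he

variable [Fintype σ]

/-- Starting from the reachable states rather than all states ensures that the first bridge can
begin at an initial state. -/
lemma langEditDist_le_of_foldl_reach_nonempty (hG : IsChomskyNormalForm G) (hA : IsSafety A)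
    (h : ∀ w ∈ G.language, ∀ d, IsCompactDecomposition G w d →
      (d.pairs.foldl (fun X p => reach A p.2 X) (reachable A)).Nonempty) :
    langEditDist G.language A.accepts ≤
      (((2 ^ (Fintype.card G.NT + 1) - 2) * Fintype.card σ + 2 ^ Fintype.card G.NT : ℕ) : ℕ∞) := by
  refine langEditDist_le_of_forall fun w hw => ?_
  obtain ⟨d, hd⟩ := exists_isCompactDecomposition hG hw
  obtain ⟨w', hw', m, hm, he⟩ := exists_editsIn_accepts hA d (h w hw d hd)
  exact ⟨w', hw', m, hm.trans (Nat.add_le_add (Nat.mul_le_mul_right _ hd.card_le) hd.length_le),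
    hd.eq_word ▸ he⟩

lemma langEditDist_eq_top_of_lt (hG : IsChomskyNormalForm G) (hA : IsSafety A)
    (h : (((2 ^ (Fintype.card G.NT + 1) - 2) * Fintype.card σ + 2 ^ Fintype.card G.NT : ℕ) : ℕ∞) <
      langEditDist G.language A.accepts) : langEditDist G.language A.accepts = ⊤ := by
  by_contra hne
  exact absurd (langEditDist_le_of_foldl_reach_nonempty hG hA fun w _ d hd =>
    foldl_reach_nonempty_of_langEditDist_ne_top hne hd.pump_mem (isForwardClosed_reachable A)
      fun q hq => ⟨[], hq⟩) (not_le.2 h)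

lemma hasEmptyNestedReach_of_langEditDist_eq_top (hG : IsChomskyNormalForm G) (hA : IsSafety A)
    (hr : AllReachable A) (h : langEditDist G.language A.accepts = ⊤) :
    HasEmptyNestedReach G A := by
  by_contra hne
  have hle := langEditDist_le_of_foldl_reach_nonempty hG hA fun w hw d hd => by
    rw [reachable_eq_univ hr]
    exact Set.nonempty_iff_ne_empty.2 fun he => hne ⟨w, hw, d, hd, he⟩
  rw [h, top_le_iff] at hle
  exact ENat.natCast_ne_top _ hle

end Comparison

end FED

theorem lemmal {α : Type*} {σ : Type*} [Fintype σ]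
    (G : ContextFreeGrammar α) [Fintype G.NT] (hG : FED.IsChomskyNormalForm G)
    (A : NFA α σ) (hA : FED.IsSafety A) :
    (FED.langEditDist G.language A.accepts = ⊤ ↔
      (((2 ^ (Fintype.card G.NT + 1) - 2) * Fintype.card σ + 2 ^ Fintype.card G.NT : ℕ) : ℕ∞) <
        FED.langEditDist G.language A.accepts) ∧
    (FED.HasEmptyNestedReach G A → FED.langEditDist G.language A.accepts = ⊤) ∧
    (FED.AllReachable A →
      List.TFAE
        [FED.langEditDist G.language A.accepts = ⊤,
          (((2 ^ (Fintype.card G.NT + 1) - 2) * Fintype.card σ + 2 ^ Fintype.card G.NT : ℕ) : ℕ∞) <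
            FED.langEditDist G.language A.accepts,
          FED.HasEmptyNestedReach G A]) := by
  have h21 := FED.langEditDist_eq_top_of_lt hG hA
  have h12 : FED.langEditDist G.language A.accepts = ⊤ →
      (((2 ^ (Fintype.card G.NT + 1) - 2) * Fintype.card σ + 2 ^ Fintype.card G.NT : ℕ) : ℕ∞) <
        FED.langEditDist G.language A.accepts := fun h => by
    rw [h]
    exact ENat.natCast_lt_top _
  refine ⟨⟨h12, h21⟩, FED.HasEmptyNestedReach.langEditDist_eq_top, fun hr => ?_⟩
  tfae_have 1 → 2 := h12
  tfae_have 2 → 1 := h21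
  tfae_have 3 → 1 := FED.HasEmptyNestedReach.langEditDist_eq_top
  tfae_have 1 → 3 := FED.hasEmptyNestedReach_of_langEditDist_eq_top hG hA hr
  tfae_finish
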